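/- Let $p \in \mathbb{R}[x,y,z]$ be a non-zero polynomial of (total) degree $\deg p$, and let $Z = \{v \in \mathbb{R}^3 : p(v) = 0\}$. Then $Z$ contains at most $(\deg p)^2$ critical irreducible real algebraic curves of $\mathbb{R}^3$; in particular there are only finitely many. Here a variety in $\mathbb{R}^3$ is the set of common zeros of finitely many real polynomials; it is irreducible if it is non-empty and is not the union of two varieties that are strict subsets of it. The dimension of an irreducible variety $V$ is the transcendence degree over $\mathbb{R}$ of $\mathbb{R}[x,y,z]/I(V)$, where $I(V)$ is the ideal of the polynomials that vanish on $V$; the dimension of a variety is the maximal dimension of the irreducible varieties contained in it, and a real algebraic curve is a variety of dimension $1$. Let $p_{sf}$ be the square-free part of $p$, i.e. the product of the distinct irreducible factors of $p$ in $\mathbb{R}[x,y,z]$ (distinct up to constants). A point $v \in Z$ is a critical point of $Z$ if $\nabla p_{sf}(v) = 0$, and a curve $\gamma \subseteq Z$ is critical if each of its points is a critical point of $Z$. -/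

import Mathlib

namespace AffineGeometry

open MvPolynomial

variable {K : Type*} [Field K] {n : ℕ}

/-- The zero set in `Kⁿ` of a polynomial in `n` variables. -/
def zeroSet (p : MvPolynomial (Fin n) K) : Set (Fin n → K) :=
  {x | eval x p = 0}

/-- A variety (algebraic set) in `Kⁿ`: the set of common zeros of finitely many polynomials. -/
def IsVariety (V : Set (Fin n → K)) : Prop :=
  ∃ S : Finset (MvPolynomial (Fin n) K), V = {x | ∀ p ∈ S, eval x p = 0}

/-- An irreducible variety: a non-empty variety which is not the union of two varieties that are
strict subsets of it. -/
def IsIrreducibleVariety (V : Set (Fin n → K)) : Prop :=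
  IsVariety V ∧ V.Nonempty ∧
    ¬ ∃ A B : Set (Fin n → K), IsVariety A ∧ IsVariety B ∧ A ⊂ V ∧ B ⊂ V ∧ V = A ∪ B

/-- The transcendence degree over `K` of the coordinate ring `K[x₁, …, xₙ] / I(V)`, which is
the dimension of `V` when `V` is an irreducible variety. -/
noncomputable def irreducibleDim (V : Set (Fin n → K)) : Cardinal :=
  Algebra.trdeg K (MvPolynomial (Fin n) K ⧸ vanishingIdeal K V)

/-- An algebraic curve: a variety of dimension `1`, where the dimension of a variety is the maximal
dimension of the irreducible varieties contained in it. -/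
def IsAlgebraicCurve (V : Set (Fin n → K)) : Prop :=
  IsVariety V ∧
    (∃ W, W ⊆ V ∧ IsIrreducibleVariety W ∧ irreducibleDim W = 1) ∧
    ∀ W, W ⊆ V → IsIrreducibleVariety W → irreducibleDim W ≤ 1

/-- An irreducible algebraic curve. -/
def IsIrreducibleCurve (V : Set (Fin n → K)) : Prop :=
  IsAlgebraicCurve V ∧ IsIrreducibleVariety V

/-- The square-free part of a non-zero polynomial: the product of its distinct irreducible factors,
one being taken from each class of factors that agree up to a non-zero constant. It is determined up
to a non-zero constant factor. -/
noncomputable def squarefreePart (p : MvPolynomial (Fin n) K) : MvPolynomial (Fin n) K :=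
  letI : StrongNormalizationMonoid (MvPolynomial (Fin n) K) :=
    UniqueFactorizationMonoid.strongNormalizationMonoid
  UniqueFactorizationMonoid.radical p

/-- A critical point of the zero set of a non-zero polynomial `p`: a point of the zero set at which
the gradient of the square-free part of `p` vanishes. -/
def IsCriticalPoint (p : MvPolynomial (Fin n) K) (x : Fin n → K) : Prop :=
  x ∈ zeroSet p ∧ ∀ i, eval x (pderiv i (squarefreePart p)) = 0

/-- A set of points, such as a curve, is critical for the zero set of `p` if each of its points is a
critical point of the zero set. -/
def IsCritical (p : MvPolynomial (Fin n) K) (γ : Set (Fin n → K)) : Prop :=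
  ∀ x ∈ γ, IsCriticalPoint p x

end AffineGeometry

open MvPolynomial

/-! ### Dimension counts in the degree filtration -/

namespace Submodule

/-! Let `q` be the square-free part of `p`. For a suitable direction `v`, the derivative `dirDeriv v
q` is coprime to `q` (`exists_isRelPrime_dirDeriv`). It vanishes on every critical curve, so these
curves lie on two surfaces without common component, of degrees at most `deg p`.

A Bézout bound, `encard_irreducibleCurve_le`, then counts them by Hilbert functions. Modulo coprime
`f`, `g` of degrees `a`, `b`, polynomials of degree at most `m` span dimension at most `a * b * m +
O(1)` (`finrank_map_restrictTotalDegree_le`). In the product of the coordinate rings of `N` distinct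
curves they span at least `N * m - O(1)` (`exists_card_mul_le_finrank_map`). Letting `m` grow gives
`N ≤ a * b`, over any field and without intersection multiplicities. -/

theorem finrank_map_eq_of_injective {K V W : Type*} [Field K] [AddCommGroup V] [Module K V]
    [AddCommGroup W] [Module K W] (φ : V →ₗ[K] W) (hφ : Function.Injective φ)
    (S : Submodule K V) : Module.finrank K (S.map φ) = Module.finrank K S :=
  (LinearEquiv.finrank_eq (equivMapOfInjective φ hφ S)).symm

theorem finrank_map_add_le {K V W : Type*} [Field K] [AddCommGroup V] [Module K V]
    [AddCommGroup W] [Module K W] (φ : V →ₗ[K] W) {S T : Submodule K V} [FiniteDimensional K S]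
    (hTS : T ≤ S) (hT : ∀ x ∈ T, φ x = 0) :
    Module.finrank K (S.map φ) + Module.finrank K T ≤ Module.finrank K S := by
  have h := LinearMap.finrank_range_add_finrank_ker (φ.domRestrict S)
  rw [LinearMap.range_domRestrict] at h
  rw [← h]
  gcongr
  rw [← finrank_map_eq_of_injective S.subtype S.injective_subtype]
  have : FiniteDimensional K ((φ.domRestrict S).ker.map S.subtype) := inferInstance
  refine Submodule.finrank_mono fun x hx => ?_
  exact ⟨⟨x, hTS hx⟩, by simpa using hT x hx, rfl⟩

end Submodule

namespace MvPolynomial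

theorem finrank_restrictTotalDegree {K : Type*} [Field K] (σ : Type*) [Fintype σ] (m : ℕ) :
    Module.finrank K (restrictTotalDegree σ K m) =
      ∑ k ∈ Finset.range (m + 1), (Fintype.card σ + k - 1).choose k := by
  classical
  have e : {n : σ →₀ ℕ | (n.sum fun _ e => e) ≤ m} =
      ((Finset.range (m + 1)).biUnion fun k => (Finset.univ : Finset σ).finsuppAntidiag k :
        Finset (σ →₀ ℕ)) := by
    ext n
    simp [Finsupp.sum_fintype]
  rw [restrictTotalDegree, Module.finrank_eq_nat_card_basis (basisRestrictSupport K _), e,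
    Nat.card_coe_set_eq, Set.ncard_coe_finset, Finset.card_biUnion]
  · simp [Finset.card_finsuppAntidiag_nat_eq_choose]
  · intro i _ j _ hij
    rw [Function.onFun, Finset.disjoint_left]
    intro n hi hj
    simp only [Finset.mem_finsuppAntidiag] at hi hj
    exact hij (hi.1.symm.trans hj.1)

theorem six_mul_finrank_restrictTotalDegree (K : Type*) [Field K] (m : ℕ) :
    6 * Module.finrank K (restrictTotalDegree (Fin 3) K m) = (m + 1) * (m + 2) * (m + 3) := by
  rw [finrank_restrictTotalDegree, Fintype.card_fin]
  induction m with
  | zero => simp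
  | succ m ih =>
    have h : 2 * (3 + (m + 1) - 1).choose (m + 1) = (m + 2) * (m + 3) := by
      have h1 : 3 + (m + 1) - 1 = (m + 1) + 2 := by omega
      rw [h1, Nat.choose_symm_add, Nat.choose_two_right, show m + 1 + 2 - 1 = m + 2 by omega,
        Nat.mul_div_cancel']
      · ring
      · rw [mul_comm]; exact (Nat.even_mul_succ_self (m + 2)).two_dvd
    rw [Finset.sum_range_succ, mul_add, ih]
    linear_combination 3 * h

/-- In the quotient of the polynomial ring by two coprime polynomials, the dimensions of the graded
pieces of the degree filtration are bounded by those of a complete intersection. -/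
theorem finrank_map_restrictTotalDegree_le {K W : Type*} [Field K] {σ : Type*} [Finite σ]
    [AddCommGroup W] [Module K W] {f g : MvPolynomial σ K} (hf : f ≠ 0) (hg : g ≠ 0)
    (hfg : IsRelPrime f g) (φ : MvPolynomial σ K →ₗ[K] W) (hφf : ∀ u, φ (f * u) = 0)
    (hφg : ∀ u, φ (g * u) = 0) (k : ℕ) :
    Module.finrank K ((restrictTotalDegree σ K (k + f.totalDegree + g.totalDegree)).map φ) +
        Module.finrank K (restrictTotalDegree σ K (k + f.totalDegree)) +
        Module.finrank K (restrictTotalDegree σ K (k + g.totalDegree)) ≤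
      Module.finrank K (restrictTotalDegree σ K (k + f.totalDegree + g.totalDegree)) +
        Module.finrank K (restrictTotalDegree σ K k) := by
  have inj : ∀ {h : MvPolynomial σ K}, h ≠ 0 → Function.Injective (LinearMap.mulLeft K h) :=
    fun hh x y hxy => mul_left_cancel₀ hh hxy
  set A := (restrictTotalDegree σ K (k + g.totalDegree)).map (LinearMap.mulLeft K f) with hA
  set B := (restrictTotalDegree σ K (k + f.totalDegree)).map (LinearMap.mulLeft K g) with hB
  -- Coprimality enters here: a common multiple of `f` and `g` is a multiple of `f * g`.
  -- Inclusion-exclusion for `A ⊔ B`, which `φ` kills, gives the bound.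
  have hAB : A ⊓ B ≤ (restrictTotalDegree σ K k).map (LinearMap.mulLeft K (f * g)) := by
    rintro _ ⟨⟨u, hu, rfl⟩, ⟨w, hw, huw⟩⟩
    simp only [LinearMap.mulLeft_apply] at huw ⊢
    obtain ⟨c, rfl⟩ : g ∣ u := hfg.symm.dvd_of_dvd_mul_left ⟨w, huw.symm⟩
    refine ⟨c, ?_, by simp⟩
    rw [SetLike.mem_coe, mem_restrictTotalDegree] at hu ⊢
    rcases eq_or_ne c 0 with rfl | hc
    · simp
    · rw [totalDegree_mul_of_isDomain hg hc] at hu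
      omega
  have hsup : A ⊔ B ≤ restrictTotalDegree σ K (k + f.totalDegree + g.totalDegree) := by
    refine sup_le ?_ ?_
    · rintro _ ⟨u, hu, rfl⟩
      rw [SetLike.mem_coe, mem_restrictTotalDegree] at hu
      rw [mem_restrictTotalDegree, LinearMap.mulLeft_apply]
      have := totalDegree_mul f u
      omega
    · rintro _ ⟨u, hu, rfl⟩
      rw [SetLike.mem_coe, mem_restrictTotalDegree] at hu
      rw [mem_restrictTotalDegree, LinearMap.mulLeft_apply]
      have := totalDegree_mul g u
      omega
  have hker : ∀ x ∈ A ⊔ B, φ x = 0 := by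
    intro x hx
    obtain ⟨_, ⟨u, _, rfl⟩, _, ⟨w, _, rfl⟩, rfl⟩ := Submodule.mem_sup.mp hx
    simp [hφf, hφg]
  have h1 := Submodule.finrank_map_add_le φ hsup hker
  have h2 := Submodule.finrank_sup_add_finrank_inf_eq A B
  have h3 := Submodule.finrank_mono hAB
  rw [Submodule.finrank_map_eq_of_injective _ (inj (mul_ne_zero hf hg))] at h3
  have h4 : Module.finrank K A = _ := Submodule.finrank_map_eq_of_injective _ (inj hf) _
  have h5 : Module.finrank K B = _ := Submodule.finrank_map_eq_of_injective _ (inj hg) _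
  omega

end MvPolynomial

/-! ### Counting primes by linear growth -/

theorem Transcendental.linearIndependent_pow {K A : Type*} [Field K] [CommRing A] [Algebra K A]
    {x : A} (hx : Transcendental K x) : LinearIndependent K fun n : ℕ => x ^ n := by
  have h := (Polynomial.basisMonomials K).linearIndependent.map' (Polynomial.aeval x).toLinearMap
    (LinearMap.ker_eq_bot.mpr (transcendental_iff_injective.mp hx))
  have e : (fun n : ℕ => x ^ n) =
      (Polynomial.aeval x).toLinearMap ∘ Polynomial.basisMonomials K := by
    ext n
    simp
  rw [e]
  exact h

namespace MvPolynomial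

/-- The coordinate classes generate the quotient, so if all were algebraic the whole quotient would
be. -/
theorem exists_transcendental_mk_X {K σ : Type*} [Field K] (P : Ideal (MvPolynomial σ K))
    [Algebra.Transcendental K (MvPolynomial σ K ⧸ P)] :
    ∃ i : σ, Transcendental K (Ideal.Quotient.mk P (X i)) := by
  by_contra! h
  have hadj : Algebra.adjoin K (Set.range fun i : σ => Ideal.Quotient.mk P (X i)) = ⊤ := by
    have h1 : (aeval fun i : σ => Ideal.Quotient.mk P (X i)) = Ideal.Quotient.mkₐ K P := by
      ext i; simp
    rw [Algebra.adjoin_range_eq_range_aeval, h1, AlgHom.range_eq_top]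
    exact Ideal.Quotient.mkₐ_surjective K P
  have halg : (Algebra.adjoin K (Set.range fun i : σ => Ideal.Quotient.mk P (X i))).IsAlgebraic := by
    rw [Algebra.isAlgebraic_adjoin_iff]
    rintro _ ⟨i, rfl⟩
    exact not_not.mp (h i)
  rw [hadj] at halg
  obtain ⟨x, hx⟩ := Algebra.Transcendental.transcendental (R := K) (A := MvPolynomial σ K ⧸ P)
  exact hx (halg x trivial)

/-- The filtered pieces of the image of the polynomial ring in a product of `N` quotients by
pairwise incomparable primes of positive dimension grow at least like `N * m`. -/
theorem exists_card_mul_le_finrank_map {K σ ι : Type*} [Field K] [Finite σ] [Fintype ι]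
    (P : ι → Ideal (MvPolynomial σ K)) (hP : ∀ i, (P i).IsPrime)
    (hinc : ∀ i j, P i ≤ P j → i = j)
    (htr : ∀ i, Algebra.Transcendental K (MvPolynomial σ K ⧸ P i)) :
    ∃ e : ℕ, ∀ m : ℕ, Fintype.card ι * (m + 1) ≤ Module.finrank K
      ((restrictTotalDegree σ K (m + e)).map
        (LinearMap.pi fun i => (Ideal.Quotient.mkₐ K (P i)).toLinearMap)) := by
  classical
  -- A prime containing the intersection of the other primes would contain one of them, so each
  -- component has a polynomial isolating it.
  have hs : ∀ i, ∃ s, s ∉ P i ∧ ∀ j, j ≠ i → s ∈ P j := by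
    intro i
    have h : ¬ (Finset.univ.erase i).inf P ≤ P i := by
      rw [(hP i).inf_le']
      rintro ⟨j, hj, hji⟩
      exact Finset.ne_of_mem_erase hj (hinc j i hji)
    obtain ⟨s, hs, hsi⟩ := SetLike.not_le_iff_exists.mp h
    refine ⟨s, hsi, fun j hj => ?_⟩
    exact (Finset.inf_le (Finset.mem_erase.mpr ⟨hj, Finset.mem_univ j⟩) : _ ≤ P j) hs
  choose s hs hsj using hs
  choose k hk using fun i => exists_transcendental_mk_X (P i)
  refine ⟨Finset.univ.sup fun i => (s i).totalDegree, fun m => ?_⟩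
  set ψ : MvPolynomial σ K →ₗ[K] ∀ i, MvPolynomial σ K ⧸ P i :=
    LinearMap.pi fun i => (Ideal.Quotient.mkₐ K (P i)).toLinearMap with hψ
  set v : ι × Fin (m + 1) → MvPolynomial σ K := fun a => s a.1 * X (k a.1) ^ (a.2 : ℕ) with hv
  have hψv : ∀ a i, ψ (v a) i = if a.1 = i then
      Ideal.Quotient.mk (P i) (s i) * Ideal.Quotient.mk (P i) (X (k i)) ^ (a.2 : ℕ) else 0 := by
    intro a i
    split_ifs with h
    · subst h; simp [hψ, hv]
    · simp [hψ, hv, Ideal.Quotient.eq_zero_iff_mem.mpr (hsj a.1 i (Ne.symm h))]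
  have hli : LinearIndependent K fun a => ψ (v a) := by
    rw [Fintype.linearIndependent_iff]
    rintro c hc ⟨i, n⟩
    have h1 := congrFun hc i
    simp only [Finset.sum_apply, Pi.smul_apply, hψv, Pi.zero_apply, Fintype.sum_prod_type] at h1
    rw [Finset.sum_eq_single i (fun j _ hj => by simp [hj]) (by simp)] at h1
    simp only [if_true, ← mul_smul_comm, ← Finset.mul_sum] at h1
    have := hP i
    have h2 := (mul_eq_zero.mp h1).resolve_left
      (fun h => hs i (Ideal.Quotient.eq_zero_iff_mem.mp h))
    have h3 := (hk i).linearIndependent_pow.comp (fun n : Fin (m + 1) => (n : ℕ))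
      Fin.val_injective
    exact Fintype.linearIndependent_iff.mp h3 (fun n => c (i, n)) h2 n
  have hmem : ∀ a, ψ (v a) ∈ (restrictTotalDegree σ K
      (m + Finset.univ.sup fun i => (s i).totalDegree)).map ψ := by
    intro a
    refine Submodule.mem_map_of_mem ?_
    rw [mem_restrictTotalDegree]
    have h1 := totalDegree_mul (s a.1) (X (k a.1) ^ (a.2 : ℕ))
    have h2 : (X (k a.1) ^ (a.2 : ℕ) : MvPolynomial σ K).totalDegree = a.2 := by simp
    have h3 : (s a.1).totalDegree ≤ Finset.univ.sup fun i => (s i).totalDegree :=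
      Finset.le_sup (f := fun i => (s i).totalDegree) (Finset.mem_univ a.1)
    have h4 := a.2.isLt
    simp only [hv]
    omega
  have hli' : LinearIndependent K (fun a => (⟨ψ (v a), hmem a⟩ : (restrictTotalDegree σ K
      (m + Finset.univ.sup fun i => (s i).totalDegree)).map ψ)) :=
    LinearIndependent.of_comp (Submodule.subtype _) hli
  simpa using hli'.fintype_card_le_finrank

/-- The primes of dimension one over two coprime polynomials in three variables are at most as many
as the product of the degrees. -/
theorem card_le_totalDegree_mul_totalDegree {K ι : Type*} [Field K] [Fintype ι]
    {f g : MvPolynomial (Fin 3) K} (hf : f ≠ 0) (hg : g ≠ 0) (hfg : IsRelPrime f g)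
    (P : ι → Ideal (MvPolynomial (Fin 3) K)) (hP : ∀ i, (P i).IsPrime)
    (hinc : ∀ i j, P i ≤ P j → i = j)
    (htr : ∀ i, Algebra.Transcendental K (MvPolynomial (Fin 3) K ⧸ P i))
    (hfP : ∀ i, f ∈ P i) (hgP : ∀ i, g ∈ P i) :
    Fintype.card ι ≤ f.totalDegree * g.totalDegree := by
  obtain ⟨e, he⟩ := exists_card_mul_le_finrank_map P hP hinc htr
  set a := f.totalDegree
  set b := g.totalDegree
  by_contra! hlt
  -- The alternating sum of the four dimensions is exactly `a * b * (k + e + 2) + a * b * (a + b) /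
  -- 2`; the halving is dropped.
  have key : ∀ k : ℕ, Fintype.card ι * (k + a + b + 1) ≤
      a * b * (k + e + 2) + a * b * (a + b) := by
    intro k
    have h1 := he (k + a + b)
    have h2 := finrank_map_restrictTotalDegree_le hf hg hfg
      (LinearMap.pi fun i => (Ideal.Quotient.mkₐ K (P i)).toLinearMap)
      (fun u => by
        ext i
        simp [Ideal.Quotient.eq_zero_iff_mem.mpr (hfP i)])
      (fun u => by
        ext i
        simp [Ideal.Quotient.eq_zero_iff_mem.mpr (hgP i)]) (k + e)
    have e1 := six_mul_finrank_restrictTotalDegree K (k + e + a + b)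
    have e2 := six_mul_finrank_restrictTotalDegree K (k + e + a)
    have e3 := six_mul_finrank_restrictTotalDegree K (k + e + b)
    have e4 := six_mul_finrank_restrictTotalDegree K (k + e)
    rw [show k + a + b + e = k + e + a + b by ring] at h1
    zify at *
    nlinarith [mul_nonneg (mul_nonneg (Int.natCast_nonneg a) (Int.natCast_nonneg b))
      (add_nonneg (Int.natCast_nonneg a) (Int.natCast_nonneg b))]
  -- Large enough for slope `a * b + 1` on the left to beat slope `a * b` on the right.
  obtain ⟨k, hk⟩ : ∃ k, k = a * b * (e + 2) + a * b * (a + b) := ⟨_, rfl⟩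
  have h1 := (Nat.mul_le_mul_right (k + a + b + 1) hlt).trans (key k)
  nlinarith [Nat.zero_le (a * b * (a + b + 1))]

end MvPolynomial

/-! ### Generic directional derivatives -/

namespace MvPolynomial

/-- The derivative of a polynomial in the direction `v`. -/
noncomputable def dirDeriv {K σ : Type*} [Field K] [Fintype σ] (v : σ → K) :
    Derivation K (MvPolynomial σ K) (MvPolynomial σ K) :=
  ∑ i, v i • pderiv i

theorem dirDeriv_apply {K σ : Type*} [Field K] [Fintype σ] (v : σ → K) (f : MvPolynomial σ K) :
    dirDeriv v f = ∑ i, v i • pderiv i f := by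
  rw [dirDeriv, ← Derivation.coeFnAddMonoidHom_apply, map_sum, Finset.sum_apply]
  rfl

theorem eval_dirDeriv {K σ : Type*} [Field K] [Fintype σ] (v x : σ → K) (f : MvPolynomial σ K) :
    eval x (dirDeriv v f) = ∑ i, v i * eval x (pderiv i f) := by
  simp [dirDeriv_apply, smul_eval]

theorem totalDegree_dirDeriv_lt {K σ : Type*} [Field K] [Fintype σ] {v : σ → K}
    {f : MvPolynomial σ K} (h : dirDeriv v f ≠ 0) :
    (dirDeriv v f).totalDegree < f.totalDegree := by
  have key : ∀ m ∈ (dirDeriv v f).support, (m.sum fun _ e => e) < f.totalDegree := by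
    intro m hm
    rw [mem_support_iff, dirDeriv_apply, coeff_sum] at hm
    obtain ⟨i, _, hi⟩ := Finset.exists_ne_zero_of_sum_ne_zero hm
    rw [coeff_smul, coeff_pderiv] at hi
    have h1 : coeff (m + Finsupp.single i 1) f ≠ 0 := by
      intro h0
      simp [h0] at hi
    have h2 := le_totalDegree (mem_support_iff.mpr h1)
    rw [Finsupp.sum_add_index' (by simp) (by simp), Finsupp.sum_single_index rfl] at h2
    omega
  obtain ⟨m, hm⟩ := support_nonempty.mpr h
  rw [totalDegree, Finset.sup_lt_iff (lt_of_le_of_lt (Nat.zero_le _) (key m hm))]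
  exact key

theorem dirDeriv_eq_zero_of_dvd {K σ : Type*} [Field K] [Fintype σ] {v : σ → K}
    {f : MvPolynomial σ K} (h : f ∣ dirDeriv v f) : dirDeriv v f = 0 := by
  by_contra h0
  exact (totalDegree_le_of_dvd_of_isDomain h h0).not_gt (totalDegree_dirDeriv_lt h0)

theorem exists_pderiv_ne_zero {K σ : Type*} [Field K] [CharZero K]
    {f : MvPolynomial σ K} (hf : f.totalDegree ≠ 0) : ∃ i, pderiv i f ≠ 0 := by
  by_contra! h
  refine hf (totalDegree_eq_zero_iff_eq_C.mpr ?_)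
  classical
  ext s
  rw [coeff_C]
  split_ifs with hs
  · rw [hs]
  obtain ⟨i, hi⟩ : ∃ i, s i ≠ 0 := by
    by_contra! h0
    exact hs (Finsupp.ext fun i => (h0 i).symm)
  have h1 := coeff_pderiv (i := i) f (s - Finsupp.single i 1)
  rw [h i, coeff_zero, Finsupp.sub_add_single_one_cancel hi] at h1
  exact (mul_eq_zero.mp h1.symm).resolve_right (Nat.cast_add_one_ne_zero _)

/-- A square-free polynomial is coprime to its derivative in a suitable direction. -/
theorem exists_isRelPrime_dirDeriv {K σ : Type*} [Field K] [CharZero K] [Fintype σ]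
    {q : MvPolynomial σ K} (hq : Squarefree q) :
    ∃ v : σ → K, IsRelPrime q (dirDeriv v q) := by
  classical
  have hq0 : q ≠ 0 := hq.ne_zero
  let L : MvPolynomial σ K → (σ → K) →ₗ[K] MvPolynomial σ K := fun f =>
    Fintype.linearCombination K fun i => pderiv i f
  have hL : ∀ f v, L f v = dirDeriv v f := fun f v => by
    rw [dirDeriv_apply, Fintype.linearCombination_apply]
  let F := (UniqueFactorizationMonoid.factors q).toFinset
  have hF : ∀ f ∈ F, Irreducible f := fun f hf =>
    UniqueFactorizationMonoid.irreducible_of_factor f (Multiset.mem_toFinset.mp hf)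
  -- For each irreducible factor the directions killing it form a proper subspace; finitely many of
  -- these cannot cover the space over an infinite field.
  have htop : (⊤ : Subspace K (σ → K)) ∉ F.image fun f => (L f).ker := by
    rw [Finset.mem_image]
    rintro ⟨f, hf, hker⟩
    have hdeg : f.totalDegree ≠ 0 := by
      intro h0
      rw [totalDegree_eq_zero_iff_eq_C] at h0
      have hne := (hF f hf).ne_zero
      refine (hF f hf).not_isUnit ?_
      rw [h0] at hne ⊢
      exact (IsUnit.mk0 _ fun hc => hne (by rw [hc, C_0])).map C
    obtain ⟨i, hi⟩ := exists_pderiv_ne_zero hdeg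
    refine hi ?_
    have h1 : L f (Pi.single i 1) = 0 :=
      LinearMap.mem_ker.mp (hker ▸ Submodule.mem_top)
    simpa [L, Fintype.linearCombination_apply_single] using h1
  obtain ⟨v, hv⟩ := (Set.ne_univ_iff_exists_notMem _).mp
    (Subspace.biUnion_ne_univ_of_top_notMem htop)
  refine ⟨v, WfDvdMonoid.isRelPrime_of_no_irreducible_factors (fun h => hq0 h.1) ?_⟩
  intro r hr hrq hrg
  obtain ⟨f, hfF, hrf⟩ := UniqueFactorizationMonoid.exists_mem_factors_of_dvd hq0 hr hrq
  have hfF' : f ∈ F := Multiset.mem_toFinset.mpr hfF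
  have hne : dirDeriv v f ≠ 0 := by
    intro h0
    refine hv (Set.mem_iUnion₂.mpr ⟨(L f).ker, Finset.mem_image_of_mem _ hfF', ?_⟩)
    exact LinearMap.mem_ker.mpr (by rw [hL, h0])
  obtain ⟨h, rfl⟩ : f ∣ q := hrf.symm.dvd.trans hrq
  have hdvd : f ∣ h * dirDeriv v f := by
    have h1 : f ∣ dirDeriv v (f * h) := hrf.symm.dvd.trans hrg
    rw [Derivation.leibniz, smul_eq_mul, smul_eq_mul] at h1
    exact (dvd_add_right (dvd_mul_right _ _)).mp h1
  rcases (hF f hfF').prime.dvd_or_dvd hdvd with h1 | h1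
  · exact (hF f hfF').not_isUnit (hq f (mul_dvd_mul_left f h1))
  · exact hne (dirDeriv_eq_zero_of_dvd h1)

end MvPolynomial

/-! ### From curves to incomparable primes -/

/-- A proper quotient of a domain of transcendence degree one is algebraic. -/
theorem AlgHom.injective_of_trdeg_le_one {K A B : Type*} [Field K] [CommRing A] [IsDomain A]
    [CommRing B] [Algebra K A] [Algebra K B] [Algebra.Transcendental K B]
    (hA : Algebra.trdeg K A ≤ 1) (φ : A →ₐ[K] B) (hφ : Function.Surjective φ) :
    Function.Injective φ := by
  rw [injective_iff_map_eq_zero]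
  by_contra! h
  obtain ⟨u, hu, hu0⟩ := h
  obtain ⟨t, ht⟩ := Algebra.Transcendental.transcendental (R := K) (A := B)
  obtain ⟨T, rfl⟩ := hφ t
  have hT : Transcendental K T := fun h => ht (h.algHom φ)
  have hTi : AlgebraicIndependent K fun _ : Unit => T :=
    algebraicIndependent_unique_type_iff.mpr hT
  -- Since `u` is algebraic over `K[T]`, it divides a nonzero `F(T)`; as `φ u = 0`, this makes `φ T`
  -- a root of `F`.
  have halg : IsAlgebraic (Algebra.adjoin K (Set.range fun _ : Unit => T)) u := by
    by_contra htr
    have h1 := ((hTi.option_iff_transcendental u).mpr htr).lift_cardinalMk_le_trdeg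
    have h2 := h1.trans (Cardinal.lift_le.mpr hA)
    simp at h2
  obtain ⟨r, hr0, hur⟩ := halg.exists_nonzero_dvd (mem_nonZeroDivisors_of_ne_zero hu0)
  obtain ⟨F, hF⟩ : ∃ F : Polynomial K, Polynomial.aeval T F = (r : A) := by
    have h1 : ∀ y ∈ Algebra.adjoin K (Set.range fun _ : Unit => T),
        ∃ F : Polynomial K, Polynomial.aeval T F = y := by
      rw [Set.range_const, Algebra.adjoin_singleton_eq_range_aeval]
      exact fun y hy => hy
    exact h1 r r.2
  have hF0 : Polynomial.aeval (φ T) F = 0 := by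
    rw [Polynomial.aeval_algHom_apply, hF]
    obtain ⟨c, hc⟩ := hur
    change (r : A) = u * c at hc
    rw [hc, map_mul, hu, zero_mul]
  have hFz : F = 0 := transcendental_iff.mp ht F hF0
  rw [hFz, map_zero] at hF
  exact hr0 (Subtype.ext hF.symm)

namespace AffineGeometry

variable {K : Type*} [Field K] {n : ℕ}

theorem IsVariety.inter_zeroSet {V : Set (Fin n → K)} (hV : IsVariety V)
    (p : MvPolynomial (Fin n) K) : IsVariety (V ∩ zeroSet p) := by
  classical
  obtain ⟨S, rfl⟩ := hV
  refine ⟨insert p S, ?_⟩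
  ext x
  simp [zeroSet, and_comm]

theorem IsVariety.mem_of_forall_vanishingIdeal {V : Set (Fin n → K)} (hV : IsVariety V)
    {x : Fin n → K} (hx : ∀ p ∈ vanishingIdeal K V, eval x p = 0) : x ∈ V := by
  obtain ⟨S, rfl⟩ := hV
  exact fun p hp => hx p fun y hy => by simpa using hy p hp

theorem IsVariety.subset_of_vanishingIdeal_le {V W : Set (Fin n → K)} (hV : IsVariety V)
    (h : vanishingIdeal K V ≤ vanishingIdeal K W) : W ⊆ V := fun x hx =>
  hV.mem_of_forall_vanishingIdeal fun p hp => by simpa using h hp x hx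

theorem IsIrreducibleVariety.isPrime_vanishingIdeal {V : Set (Fin n → K)}
    (hV : IsIrreducibleVariety V) : (vanishingIdeal K V).IsPrime := by
  obtain ⟨hvar, ⟨x, hx⟩, hirr⟩ := hV
  refine ⟨fun h => ?_, fun {f g} hfg => ?_⟩
  · have h1 : (1 : MvPolynomial (Fin n) K) ∈ vanishingIdeal K V := h ▸ Submodule.mem_top
    simpa using h1 x hx
  · by_contra! hcon
    have hss : ∀ f, f ∉ vanishingIdeal K V → V ∩ zeroSet f ⊂ V := by
      refine fun f hf => Set.inter_subset_left.ssubset_of_ne fun h => hf fun y hy => ?_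
      simpa [zeroSet] using (h.symm.subset hy).2
    refine hirr ⟨_, _, hvar.inter_zeroSet f, hvar.inter_zeroSet g, hss f hcon.1, hss g hcon.2, ?_⟩
    rw [← Set.inter_union_distrib_left, eq_comm, Set.inter_eq_left]
    intro y hy
    have h1 := hfg y hy
    simpa [zeroSet] using h1

/-- The dimension of a curve is witnessed by some `W` inside it; the coordinate ring of `γ` surjects
onto that of `W`. -/
theorem IsIrreducibleCurve.irreducibleDim_eq_one {γ : Set (Fin n → K)}
    (h : IsIrreducibleCurve γ) : irreducibleDim γ = 1 := by
  obtain ⟨⟨_, ⟨W, hWγ, _, hW⟩, hmax⟩, hirr⟩ := h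
  refine le_antisymm (hmax γ subset_rfl hirr) (hW.symm.le.trans ?_)
  have hle : vanishingIdeal K γ ≤ vanishingIdeal K W := vanishingIdeal_anti_mono hWγ
  exact trdeg_le_of_surjective
    (Ideal.Quotient.factorₐ K hle)
    (Ideal.Quotient.factor_surjective hle)

theorem IsIrreducibleCurve.transcendental {γ : Set (Fin n → K)} (h : IsIrreducibleCurve γ) :
    Algebra.Transcendental K (MvPolynomial (Fin n) K ⧸ vanishingIdeal K γ) := by
  rw [← trdeg_ne_zero_iff]
  have := h.irreducibleDim_eq_one
  rw [irreducibleDim] at this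
  simp [this]

theorem IsIrreducibleCurve.eq_of_vanishingIdeal_le {γ δ : Set (Fin n → K)}
    (hγ : IsIrreducibleCurve γ) (hδ : IsIrreducibleCurve δ)
    (h : vanishingIdeal K γ ≤ vanishingIdeal K δ) : γ = δ := by
  have := hγ.2.isPrime_vanishingIdeal
  have := hδ.transcendental
  have hinj := AlgHom.injective_of_trdeg_le_one hγ.irreducibleDim_eq_one.le
    (Ideal.Quotient.factorₐ K h) (Ideal.Quotient.factor_surjective h)
  refine (hδ.1.1.subset_of_vanishingIdeal_le fun p hp => ?_).antisymm
    (hγ.1.1.subset_of_vanishingIdeal_le h)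
  rw [← Ideal.Quotient.eq_zero_iff_mem] at hp ⊢
  exact hinj (by simpa using hp)

/-- A set of irreducible space curves lying on two surfaces without a common component has
at most as many elements as the product of the degrees. -/
theorem encard_irreducibleCurve_le {f g : MvPolynomial (Fin 3) K} (hf : f ≠ 0) (hg : g ≠ 0)
    (hfg : IsRelPrime f g) {C : Set (Set (Fin 3 → K))}
    (hC : ∀ γ ∈ C, IsIrreducibleCurve γ ∧ γ ⊆ zeroSet f ∧ γ ⊆ zeroSet g) :
    C.encard ≤ ((f.totalDegree * g.totalDegree : ℕ) : ℕ∞) := by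
  by_contra! hlt
  obtain ⟨t, htC, ht⟩ := Set.exists_subset_encard_eq (Order.add_one_le_of_lt hlt)
  have hfin : t.Finite := Set.finite_of_encard_eq_coe (k := f.totalDegree * g.totalDegree + 1)
    (by exact_mod_cast ht)
  have := hfin.fintype
  have hle := card_le_totalDegree_mul_totalDegree hf hg hfg
    (fun γ : t => vanishingIdeal K (γ : Set (Fin 3 → K)))
    (fun γ => (hC γ (htC γ.2)).1.2.isPrime_vanishingIdeal)
    (fun γ δ h => Subtype.ext
      ((hC γ (htC γ.2)).1.eq_of_vanishingIdeal_le (hC δ (htC δ.2)).1 h))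
    (fun γ => (hC γ (htC γ.2)).1.transcendental)
    (fun γ x hx => by simpa [zeroSet] using (hC γ (htC γ.2)).2.1 hx)
    (fun γ x hx => by simpa [zeroSet] using (hC γ (htC γ.2)).2.2 hx)
  rw [← Set.coe_fintypeCard] at ht
  have h1 : Fintype.card t = f.totalDegree * g.totalDegree + 1 := by exact_mod_cast ht
  omega

theorem squarefree_squarefreePart (p : MvPolynomial (Fin n) K) : Squarefree (squarefreePart p) :=
  letI : StrongNormalizationMonoid (MvPolynomial (Fin n) K) :=
    UniqueFactorizationMonoid.strongNormalizationMonoid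
  UniqueFactorizationMonoid.squarefree_radical

theorem squarefreePart_dvd (p : MvPolynomial (Fin n) K) : squarefreePart p ∣ p :=
  letI : StrongNormalizationMonoid (MvPolynomial (Fin n) K) :=
    UniqueFactorizationMonoid.strongNormalizationMonoid
  UniqueFactorizationMonoid.radical_dvd_self

theorem exists_dvd_squarefreePart_pow {p : MvPolynomial (Fin n) K} (hp : p ≠ 0) :
    ∃ k, p ∣ squarefreePart p ^ k :=
  letI : StrongNormalizationMonoid (MvPolynomial (Fin n) K) :=
    UniqueFactorizationMonoid.strongNormalizationMonoid
  UniqueFactorizationMonoid.exists_dvd_radical_self_pow hp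

theorem zeroSet_subset_zeroSet_squarefreePart {p : MvPolynomial (Fin n) K} (hp : p ≠ 0) :
    zeroSet p ⊆ zeroSet (squarefreePart p) := by
  intro x hx
  obtain ⟨k, r, hr⟩ := exists_dvd_squarefreePart_pow hp
  have h1 := congrArg (eval x) hr
  rw [map_pow, map_mul, show eval x p = 0 from hx, zero_mul] at h1
  exact eq_zero_of_pow_eq_zero h1

end AffineGeometry

theorem corollary4p1p14 (p : MvPolynomial (Fin 3) ℝ) (hp : p ≠ 0) :
    {γ : Set (Fin 3 → ℝ) | AffineGeometry.IsIrreducibleCurve γ ∧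
        γ ⊆ AffineGeometry.zeroSet p ∧ AffineGeometry.IsCritical p γ}.encard ≤
      ((p.totalDegree ^ 2 : ℕ) : ℕ∞) := by
  set q := AffineGeometry.squarefreePart p with hq
  have hsq : Squarefree q := AffineGeometry.squarefree_squarefreePart p
  have hqp : q.totalDegree ≤ p.totalDegree :=
    totalDegree_le_of_dvd_of_isDomain (AffineGeometry.squarefreePart_dvd p) hp
  have hpq := AffineGeometry.zeroSet_subset_zeroSet_squarefreePart hp
  obtain ⟨v, hv⟩ := exists_isRelPrime_dirDeriv hsq
  by_cases hg : dirDeriv v q = 0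
  -- Here `q` is a unit, so its zero set is empty and contains no curve.
  · rw [hg, isRelPrime_zero_right] at hv
    refine (Set.encard_eq_zero.mpr (Set.eq_empty_iff_forall_notMem.mpr ?_)).trans_le bot_le
    rintro γ ⟨hγ, hγp, -⟩
    obtain ⟨x, hx⟩ := hγ.2.2.1
    exact (hv.map (eval x)).ne_zero (hpq (hγp hx))
  · refine (AffineGeometry.encard_irreducibleCurve_le hsq.ne_zero hg hv ?_).trans ?_
    · rintro γ ⟨hγ, hγp, hcrit⟩
      refine ⟨hγ, hγp.trans hpq, fun x hx => ?_⟩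
      change eval x (dirDeriv v q) = 0
      rw [eval_dirDeriv]
      exact Finset.sum_eq_zero fun i _ => by rw [(hcrit x hx).2 i, mul_zero]
    · rw [sq]
      exact_mod_cast Nat.mul_le_mul hqp ((totalDegree_dirDeriv_lt hg).le.trans hqp)
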